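/- Let $G$ be an undirected graph with vertex set $[n]=\{0,\dots,n-1\}$, $n\ge 1$, and let $M\in\{0,1\}^{n\times n}$ be its adjacency matrix (self-loops, i.e. the diagonal entries of $M$, play no role). The matrix is accessible only through queries, where one query is one application of the unitary $O_M:|i,j,b\rangle\mapsto|i,j,b\oplus M_{ij}\rangle$. Consider the following quantum algorithm with classical control. 1. Initially the edge set $A$ is empty. 2. Repeat until $A$ connects all vertices: search for a good edge, that is, a pair $(i,j)\in[n]^2$ with $M_{ij}=1$ such that $i$ and $j$ lie in different components of $([n],A)$, and add $\{i,j\}$ to $A$. 3. Return $A$. Each search in step 2 is the quantum search for an unknown number of solutions (Boyer, Brassard, Høyer, Tapp) on the domain $[n]^2$ of size $N=n^2$. In round $r=0,1,2,\dots$ choose an integer $l$ uniformly at random with $0\le l<\min\big((6/5)^r,\sqrt N\big)$; start from the uniform superposition $\frac1n\sum_{i,j}|i,j\rangle\otimes\frac{|0\rangle-|1\rangle}{\sqrt2}$; apply $l$ Grover iterations, each consisting of a change of sign of all good pairs (made with one query) followed by the reflection about the initial state; measure a pair $(i,j)$; query $M_{ij}$. If $(i,j)$ is good the search ends with it, and otherwise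 the search goes on with round $r+1$. (So a search runs forever if there is no good pair.) There is a constant $C>0$, independent of $n$ and $G$, such that: * if $G$ is connected, then with probability $1$ the algorithm halts and outputs the edge set of a spanning tree of $G$, and the expected total number of queries to $M$ that it makes until then is at most $C\,n^{3/2}$; * if $G$ is not connected, then the algorithm runs forever: it never halts. -/

import Mathlib

open scoped Classical ENNReal

noncomputable section

/-! ## Quantum query algorithms with classical control, in the adjacency matrix model -/

/-- Computational basis: a query register (row, column, answer bit) and a workspace `W`. -/
abbrev QBasis (n : ℕ) (W : Type) : Type := Fin n × Fin n × Bool × W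

/-- The state space of the quantum computer. -/
abbrev QState (n : ℕ) (W : Type) [Fintype W] : Type := EuclideanSpace ℂ (QBasis n W)

/-- One query on basis states: `|i, j, b, w⟩ ↦ |i, j, b ⊕ M i j, w⟩`. -/
def oraclePerm {n : ℕ} (W : Type) (M : Matrix (Fin n) (Fin n) Bool) :
    Equiv.Perm (QBasis n W) :=
  Function.Involutive.toPerm (fun x => (x.1, x.2.1, xor x.2.2.1 (M x.1 x.2.1), x.2.2.2))
    (fun x => by simp)

/-- The query unitary of the matrix `M`. -/
def oracle {n : ℕ} (W : Type) [Fintype W] (M : Matrix (Fin n) (Fin n) Bool) :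
    QState n W ≃ₗᵢ[ℂ] QState n W :=
  LinearIsometryEquiv.piLpCongrLeft 2 ℂ ℂ (oraclePerm W M)

/-- A gate is a unitary that does not depend on the input, or a query to the input. -/
inductive Gate (n : ℕ) (W : Type) [Fintype W] : Type
  | unitary (U : QState n W ≃ₗᵢ[ℂ] QState n W) : Gate n W
  | query : Gate n W

namespace Gate

variable {n : ℕ} {W : Type} [Fintype W]

/-- The unitary performed by a gate when the input is `M`. -/
def toUnitary (M : Matrix (Fin n) (Fin n) Bool) : Gate n W → (QState n W ≃ₗᵢ[ℂ] QState n W)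
  | unitary U => U
  | query => oracle W M

/-- The number of queries made by a gate. -/
def queries : Gate n W → ℕ
  | unitary _ => 0
  | query => 1

/-- Apply the gates of a circuit, the head of the list first. -/
def run (M : Matrix (Fin n) (Fin n) Bool) (c : List (Gate n W)) (ψ : QState n W) : QState n W :=
  c.foldl (fun φ g => g.toUnitary M φ) ψ

theorem norm_run (M : Matrix (Fin n) (Fin n) Bool) (c : List (Gate n W)) (ψ : QState n W) :
    ‖run M c ψ‖ = ‖ψ‖ := by
  induction c generalizing ψ with
  | nil => rfl
  | cons g c ih =>
    have h : run M (g :: c) ψ = run M c (g.toUnitary M ψ) := rfl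
    rw [h, ih, LinearIsometryEquiv.norm_map]

end Gate

theorem sum_normSq_eq_one {n : ℕ} {W : Type} [Fintype W] (ψ : QState n W) (h : ‖ψ‖ = 1) :
    ∑ x, ENNReal.ofReal (‖ψ x‖ ^ 2) = 1 := by
  rw [← ENNReal.ofReal_sum_of_nonneg (fun x _ => by positivity),
    ← EuclideanSpace.norm_sq_eq, h]
  simp

/-- Measurement of a unit vector in the computational basis: outcome `x` has probability
`|ψ x|²`. -/
def measurePMF {n : ℕ} {W : Type} [Fintype W] (ψ : QState n W) (h : ‖ψ‖ = 1) :
    PMF (QBasis n W) :=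
  PMF.ofFintype (fun x => ENNReal.ofReal (‖ψ x‖ ^ 2)) (sum_normSq_eq_one ψ h)

/-- What the classical control with memory `S` does next: stop and return `a`; choose its next
memory content at random; or prepare the unit vector `ψ`, run the circuit `c` on it, measure all
qubits, and let the outcome determine the next memory content. -/
inductive ControlAction (n : ℕ) (W : Type) [Fintype W] (S Out : Type) : Type
  | halt (a : Out) : ControlAction n W S Out
  | choose (p : PMF S) : ControlAction n W S Out
  | measure (ψ : Metric.sphere (0 : QState n W) 1) (c : List (Gate n W))
      (next : QBasis n W → S) : ControlAction n W S Out

/-- A quantum query algorithm for `n × n` Boolean matrices. The input matrix is not available to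
it other than through query gates. -/
structure QueryAlgorithm (n : ℕ) (W : Type) [Fintype W] (Out : Type) where
  State : Type
  init : State
  action : State → ControlAction n W State Out

namespace QueryAlgorithm

variable {n : ℕ} {W : Type} [Fintype W] {Out : Type}

/-- One step of the algorithm on input `M`. A configuration consists of the classical memory and
the number of queries made so far; halted configurations do not change any more. -/
def step (alg : QueryAlgorithm n W Out) (M : Matrix (Fin n) (Fin n) Bool)
    (x : alg.State × ℕ) : PMF (alg.State × ℕ) :=
  match alg.action x.1 with
  | .halt _ => PMF.pure x
  | .choose p => p.map (fun s => (s, x.2))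
  | .measure ψ c next =>
      (measurePMF (Gate.run M c ψ.1) (by rw [Gate.norm_run]; exact mem_sphere_zero_iff_norm.mp ψ.2)).map
        (fun y => (next y, x.2 + (c.map Gate.queries).sum))

/-- The distribution of the configuration after `k` steps. -/
def runFor (alg : QueryAlgorithm n W Out) (M : Matrix (Fin n) (Fin n) Bool) :
    ℕ → PMF (alg.State × ℕ)
  | 0 => PMF.pure (alg.init, 0)
  | k + 1 => (alg.runFor M k).bind (alg.step M)

/-- The probability that the algorithm halts with an output that satisfies `P`. -/
def probOutput (alg : QueryAlgorithm n W Out) (M : Matrix (Fin n) (Fin n) Bool)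
    (P : Out → Prop) : ℝ≥0∞ :=
  ⨆ k, (alg.runFor M k).toOuterMeasure {x | ∃ a, alg.action x.1 = .halt a ∧ P a}

/-- The expected number of queries made in the whole run (until the algorithm halts): the limit
of the expected number of queries made in the first `k` steps. -/
def expectedQueries (alg : QueryAlgorithm n W Out) (M : Matrix (Fin n) (Fin n) Bool) : ℝ≥0∞ :=
  ⨆ k, ∑' x : alg.State × ℕ, alg.runFor M k x * (x.2 : ℝ≥0∞)

/-- No configuration that is reached with positive probability is halted. -/
def RunsForever (alg : QueryAlgorithm n W Out) (M : Matrix (Fin n) (Fin n) Bool) : Prop :=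
  ∀ k, ∀ x ∈ (alg.runFor M k).support, ∀ a, alg.action x.1 ≠ .halt a

end QueryAlgorithm

/-! ## The greedy algorithm -/

namespace SpanningTree

variable {n : ℕ}

/-- The graph on the vertex set `Fin n` whose edges are those in `A`. -/
abbrev graphOf (A : Finset (Sym2 (Fin n))) : SimpleGraph (Fin n) :=
  SimpleGraph.fromEdgeSet (A : Set (Sym2 (Fin n)))

/-- Amplitudes of the uniform superposition of all `(i, j)`, tensored with
`(|0⟩ - |1⟩) / √2`. -/
def uniformVec (n : ℕ) : QState n Unit :=
  WithLp.toLp 2 fun x => (if x.2.2.1 then -1 else 1) / ((n : ℂ) * (Real.sqrt 2 : ℂ))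

theorem norm_uniformVec (n : ℕ) [NeZero n] : ‖uniformVec n‖ = 1 := by
  have hn : (n : ℝ) ≠ 0 := Nat.cast_ne_zero.mpr (NeZero.ne n)
  have h : ‖uniformVec n‖ ^ 2 = 1 := by
    rw [EuclideanSpace.norm_sq_eq]
    have hx : ∀ x : QBasis n Unit, ‖uniformVec n x‖ ^ 2 = 1 / ((n : ℝ) ^ 2 * 2) := by
      intro x
      have h1 : ‖(if x.2.2.1 then (-1 : ℂ) else 1)‖ = 1 := by split_ifs <;> simp
      have h2 : ‖uniformVec n x‖ = 1 / ((n : ℝ) * Real.sqrt 2) := by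
        simp only [uniformVec, norm_div, norm_mul, h1]
        simp [abs_of_nonneg]
      rw [h2, div_pow, mul_pow, Real.sq_sqrt (by norm_num)]
      simp
    rw [Finset.sum_congr rfl fun x _ => hx x]
    simp
    field_simp
  nlinarith [norm_nonneg (uniformVec n)]

/-- The initial state of the quantum search. -/
def uniformState (n : ℕ) [NeZero n] : Metric.sphere (0 : QState n Unit) 1 :=
  ⟨uniformVec n, by simpa using norm_uniformVec n⟩

/-- The basis state `|i, j, 0⟩`. -/
def entryState (i j : Fin n) : Metric.sphere (0 : QState n Unit) 1 :=
  ⟨EuclideanSpace.single (i, j, false, ()) 1, by simp⟩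

/-- The diagonal unitary with `|i, j, b⟩ ↦ -|i, j, b⟩` if `b = 1` and `i`, `j` are in the same
component of `A`, and `|i, j, b⟩ ↦ |i, j, b⟩` otherwise. -/
def maskUnitary (A : Finset (Sym2 (Fin n))) : QState n Unit ≃ₗᵢ[ℂ] QState n Unit :=
  LinearIsometryEquiv.piLpCongrRight 2 fun x : QBasis n Unit =>
    if x.2.2.1 = true ∧ (graphOf A).Reachable x.1 x.2.1 then LinearIsometryEquiv.neg ℂ
    else LinearIsometryEquiv.refl ℂ ℂ

/-- The reflection `2 |s⟩⟨s| - 1`, with `s` the initial state of the search. -/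
def diffusion (n : ℕ) : QState n Unit ≃ₗᵢ[ℂ] QState n Unit :=
  (Submodule.span ℂ {uniformVec n}).reflection

/-- One Grover iteration. With the answer bit in the state `(|0⟩ - |1⟩) / √2`, the first three
gates change the sign of exactly those `|i, j⟩` for which `{i, j}` is a good edge. -/
def groverIteration (A : Finset (Sym2 (Fin n))) : List (Gate n Unit) :=
  [.unitary (maskUnitary A), .query, .unitary (maskUnitary A), .unitary (diffusion n)]

/-- The number of admissible values of the number of Grover iterations in round `r` of a search:
the number of nonnegative integers below `min ((6/5)^r, √(n²))`. -/
def roundBound (n r : ℕ) : ℕ := ⌈min ((6 / 5 : ℝ) ^ r) (n : ℝ)⌉₊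

theorem roundBound_pos (n r : ℕ) [NeZero n] : 0 < roundBound n r := by
  have hn : (0 : ℝ) < n := Nat.cast_pos.mpr (NeZero.pos n)
  exact Nat.ceil_pos.mpr (lt_min (by positivity) hn)

/-- The classical memory: the edges `A` found so far, the round `r` of the current search, and the
current phase of that round. -/
inductive Memory (n : ℕ) : Type
  | start (A : Finset (Sym2 (Fin n))) (r : ℕ) : Memory n
  | grover (A : Finset (Sym2 (Fin n))) (r l : ℕ) : Memory n
  | check (A : Finset (Sym2 (Fin n))) (r : ℕ) (i j : Fin n) : Memory n

/-- The control of the greedy algorithm.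
* `start A r`: if `A` connects the graph, return `A`; otherwise choose a uniformly random number
  `l < roundBound n r` of Grover iterations.
* `grover A r l`: do `l` Grover iterations on the uniform superposition and measure a pair `i, j`.
* `check A r i j`: query the entry `i, j`. If `{i, j}` is a good edge, add it to `A` and start a
  new search; otherwise go to the next round of the current search. -/
def greedyControl (n : ℕ) [NeZero n] :
    Memory n → ControlAction n Unit (Memory n) (Finset (Sym2 (Fin n)))
  | .start A r =>
      if (graphOf A).Connected then .halt A
      else .choose ((PMF.uniformOfFinset (Finset.range (roundBound n r))
        (Finset.nonempty_range_iff.mpr (roundBound_pos n r).ne')).map (Memory.grover A r))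
  | .grover A r l =>
      .measure (uniformState n) (List.replicate l (groverIteration A)).flatten
        (fun x => .check A r x.1 x.2.1)
  | .check A r i j =>
      .measure (entryState i j) [.query]
        (fun x => if x.2.2.1 = true ∧ ¬ (graphOf A).Reachable i j
          then .start (insert s(i, j) A) 0 else .start A (r + 1))

/-- The greedy spanning tree algorithm for graphs with vertex set `Fin n`. -/
def greedy (n : ℕ) [NeZero n] : QueryAlgorithm n Unit (Finset (Sym2 (Fin n))) where
  State := Memory n
  init := .start ∅ 0
  action := greedyControl n

/-- `A` is the edge set of a spanning tree of `G`. -/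
def IsSpanningTree (G : SimpleGraph (Fin n)) (A : Finset (Sym2 (Fin n))) : Prop :=
  (A : Set (Sym2 (Fin n))) ⊆ G.edgeSet ∧ (graphOf A).IsTree

end SpanningTree

end

/-! If `A` has c > 1 components and G is connected, every component has an edge leaving it, so there
are t ≥ c good ordered pairs. With sin²θ = t/n², a measurement after l Grover iterations fails with
probability cos²((2l+1)θ). Averaged over l < m this is at most 3/4 once m ≥ 1/sin θ, hence once m ≥
n/√c (`sum_cos_sq_le`). Rounds before that point cost a geometric sum of order n/√c. After it,
lengths grow by 6/5 while survival shrinks by 3/4, and 3/4 · 6/5 < 1, so a search costs O(n/√c).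
Each success lowers c, and summing n/√c over c ≤ n gives O(n^(3/2)).

This is made rigorous by a potential: queries made plus `potential` never increases in expectation
(the `expect_totalCost_*_le` lemmas). The heart is `sum_round_le`, the accounting of one round.

The bound on queries also forces halting: a run still active after k steps has made at least (k-2)/3
queries, so by Markov's inequality this has probability O(1/k). The output is a spanning tree
because `A` is always a forest inside G. For the same reason a connected `A` makes G connected, so
on a disconnected G no halted configuration is reachable. -/

/-! ## Expectations with respect to a probability mass function -/

namespace PMF

/-- The expectation of an extended nonnegative function. -/
noncomputable def expect {α : Type*} (p : PMF α) (f : α → ℝ≥0∞) : ℝ≥0∞ := ∑' a, p a * f a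

variable {α β : Type*}

theorem expect_bind (p : PMF α) (q : α → PMF β) (f : β → ℝ≥0∞) :
    (p.bind q).expect f = p.expect fun a => (q a).expect f := by
  simp only [expect, bind_apply, ← ENNReal.tsum_mul_right, ← ENNReal.tsum_mul_left]
  rw [ENNReal.tsum_comm]
  simp only [mul_assoc]

theorem expect_pure (a : α) (f : α → ℝ≥0∞) : (pure a).expect f = f a := by
  rw [expect, tsum_eq_single a]
  · simp
  · intro b hb
    simp [pure_apply_of_ne _ _ hb]

theorem expect_map (p : PMF α) (g : α → β) (f : β → ℝ≥0∞) :
    (p.map g).expect f = p.expect fun a => f (g a) := by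
  rw [← bind_pure_comp, expect_bind]
  simp [expect_pure]

theorem expect_mono {p : PMF α} {f g : α → ℝ≥0∞} (h : ∀ a ∈ p.support, f a ≤ g a) :
    p.expect f ≤ p.expect g := by
  refine ENNReal.tsum_le_tsum fun a => ?_
  by_cases ha : p a = 0
  · simp [ha]
  · exact mul_le_mul_right (h a ((p.mem_support_iff a).2 ha)) _

theorem expect_const_add (p : PMF α) (c : ℝ≥0∞) (f : α → ℝ≥0∞) :
    (p.expect fun a => c + f a) = c + p.expect f := by
  simp only [expect, mul_add]
  rw [ENNReal.tsum_add, ENNReal.tsum_mul_right, p.tsum_coe, one_mul]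

theorem expect_const_mul (p : PMF α) (c : ℝ≥0∞) (f : α → ℝ≥0∞) :
    (p.expect fun a => c * f a) = c * p.expect f := by
  simp only [expect, ← ENNReal.tsum_mul_left, mul_left_comm]

theorem toOuterMeasure_le_one (p : PMF α) (S : Set α) : p.toOuterMeasure S ≤ 1 := by
  rw [toOuterMeasure_apply, ← p.tsum_coe]
  exact ENNReal.tsum_le_tsum fun a => Set.indicator_le_self S p a

/-- Markov's inequality for the complement of `S`, arranged so that nothing is subtracted in `ℝ≥0∞`.
-/
theorem le_mul_toOuterMeasure_add_expect (p : PMF α) {S : Set α} {f : α → ℝ≥0∞} {c : ℝ≥0∞}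
    (h : ∀ a ∈ p.support, a ∉ S → c ≤ f a) : c ≤ c * p.toOuterMeasure S + p.expect f := by
  conv_lhs => rw [← mul_one c, ← p.tsum_coe]
  rw [toOuterMeasure_apply, expect, ← ENNReal.tsum_mul_left, ← ENNReal.tsum_mul_left,
    ← ENNReal.tsum_add]
  refine ENNReal.tsum_le_tsum fun a => ?_
  by_cases hS : a ∈ S
  · rw [Set.indicator_of_mem hS]
    exact le_self_add
  · rw [Set.indicator_of_notMem hS, mul_zero, zero_add, mul_comm]
    by_cases ha : p a = 0
    · simp [ha]
    · exact mul_le_mul_right (h a ((p.mem_support_iff a).2 ha) hS) _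

theorem expect_uniformOfFinset (s : Finset α) (hs : s.Nonempty) (f : α → ℝ≥0∞) :
    (uniformOfFinset s hs).expect f = (s.card : ℝ≥0∞)⁻¹ * ∑ a ∈ s, f a := by
  rw [expect, tsum_eq_sum (s := s), Finset.mul_sum]
  · exact Finset.sum_congr rfl fun a ha => by rw [uniformOfFinset_apply_of_mem hs ha]
  · intro a ha
    rw [uniformOfFinset_apply_of_notMem hs ha, zero_mul]

end PMF

theorem expect_measurePMF {n : ℕ} {W : Type} [Fintype W] (ψ : QState n W) (h : ‖ψ‖ = 1)
    (f : QBasis n W → ℝ≥0∞) :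
    (measurePMF ψ h).expect f = ∑ x, ENNReal.ofReal (‖ψ x‖ ^ 2) * f x := by
  rw [PMF.expect, tsum_fintype]
  rfl

namespace QueryAlgorithm

variable {n : ℕ} {W : Type} [Fintype W] {Out : Type}

/-- The supermartingale principle. The decrease is required only on reachable configurations, so
that invariants of the run can be used to prove it. -/
theorem expect_runFor_le (alg : QueryAlgorithm n W Out) (M : Matrix (Fin n) (Fin n) Bool)
    (f : alg.State × ℕ → ℝ≥0∞)
    (h : ∀ k, ∀ x ∈ (alg.runFor M k).support, (alg.step M x).expect f ≤ f x) (k : ℕ) :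
    (alg.runFor M k).expect f ≤ f (alg.init, 0) := by
  induction k with
  | zero => exact (PMF.expect_pure _ f).le
  | succ k ih =>
    refine le_trans (le_of_eq (PMF.expect_bind _ _ f)) (le_trans (PMF.expect_mono (h k)) ih)

/-- The invariant may depend on the step number, which later allows comparing steps with queries. -/
theorem support_runFor_of_step (alg : QueryAlgorithm n W Out) (M : Matrix (Fin n) (Fin n) Bool)
    (P : ℕ → alg.State × ℕ → Prop) (h0 : P 0 (alg.init, 0))
    (h : ∀ k x, P k x → ∀ y ∈ (alg.step M x).support, P (k + 1) y) (k : ℕ) :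
    ∀ x ∈ (alg.runFor M k).support, P k x := by
  induction k with
  | zero =>
    intro x hx
    rw [runFor, PMF.mem_support_pure_iff] at hx
    exact hx ▸ h0
  | succ k ih =>
    intro y hy
    rw [runFor, PMF.mem_support_bind_iff] at hy
    obtain ⟨x, hx, hy⟩ := hy
    exact h k x (ih x hx) y hy

end QueryAlgorithm

/-! ## Trigonometry of the search with a random number of iterations -/

/-- Telescoping: 4 sin 2θ cos²((2l+1)θ) = 2 sin 2θ + sin(4(l+1)θ) - sin(4lθ). -/
theorem sum_cos_sq_mul_sin (θ : ℝ) (m : ℕ) :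
    4 * Real.sin (2 * θ) * ∑ l ∈ Finset.range m, Real.cos ((2 * l + 1) * θ) ^ 2 =
      2 * m * Real.sin (2 * θ) + Real.sin (4 * m * θ) := by
  induction m with
  | zero => simp
  | succ m ih =>
    rw [Finset.sum_range_succ, mul_add, ih]
    have h1 : Real.cos ((2 * m + 1) * θ) ^ 2 = 1 / 2 + Real.cos (4 * m * θ + 2 * θ) / 2 := by
      rw [Real.cos_sq]
      congr 3
      ring
    have h2 : 4 * ((m + 1 : ℕ) : ℝ) * θ = (4 * m * θ + 2 * θ) + 2 * θ := by push_cast; ring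
    have h3 : Real.sin (4 * m * θ) =
        Real.sin (4 * m * θ + 2 * θ) * Real.cos (2 * θ) -
          Real.cos (4 * m * θ + 2 * θ) * Real.sin (2 * θ) := by
      rw [← Real.sin_sub]; congr 1; ring
    rw [h1, h2, Real.sin_add (4 * m * θ + 2 * θ), h3]
    push_cast
    ring

/-- By the closed form, the claim is sin 4mθ ≤ m sin 2θ. It needs an argument only when sin 2θ is
small, and m sin θ ≥ 1 then puts θ near π/2. Thus no upper bound on the proportion of good pairs is
needed beyond θ < π/2. -/
theorem sum_cos_sq_le {θ : ℝ} (h0 : 0 < θ) (h1 : θ < Real.pi / 2) {m : ℕ}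
    (hm : 1 ≤ m * Real.sin θ) :
    ∑ l ∈ Finset.range m, Real.cos ((2 * l + 1) * θ) ^ 2 ≤ 3 / 4 * m := by
  have hs : 0 < Real.sin (2 * θ) := Real.sin_pos_of_pos_of_lt_pi (by linarith) (by linarith)
  suffices h : Real.sin (4 * m * θ) ≤ m * Real.sin (2 * θ) by
    have := sum_cos_sq_mul_sin θ m
    refine le_of_mul_le_mul_left (a := 4 * Real.sin (2 * θ)) ?_ (by linarith)
    rw [this]
    linarith
  by_cases hc : 1 ≤ m * Real.sin (2 * θ)
  · exact (Real.sin_le_one _).trans hc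
  push Not at hc
  -- Otherwise cos θ ≥ 1/2, and m sin 2θ = 2 m sin θ cos θ would be at least 1.
  have hθ : Real.pi / 3 < θ := by
    by_contra! hθ
    have hcos : 1 / 2 ≤ Real.cos θ := by
      rw [← Real.cos_pi_div_three]
      exact Real.cos_le_cos_of_nonneg_of_le_pi h0.le (by linarith [Real.pi_pos]) hθ
    rw [Real.sin_two_mul] at hc
    nlinarith
  set ε := Real.pi / 2 - θ with hε
  have hsε : Real.sin (2 * θ) = Real.sin (2 * ε) := by
    rw [hε, ← Real.sin_pi_sub (2 * θ)]; congr 1; ring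
  have hj : 2 / Real.pi * (2 * ε) ≤ Real.sin (2 * ε) :=
    Real.mul_le_sin (by linarith) (by linarith)
  have hlt : 4 * m * ε < Real.pi := by
    have h2 : (m : ℝ) * (2 / Real.pi * (2 * ε)) < 1 :=
      lt_of_le_of_lt (mul_le_mul_of_nonneg_left hj (Nat.cast_nonneg m)) (hsε ▸ hc)
    have h3 : (m : ℝ) * (2 / Real.pi * (2 * ε)) = 4 * m * ε / Real.pi := by ring
    rw [h3, div_lt_one Real.pi_pos] at h2
    exact h2
  -- 4mθ = 2πm - 4mε, and Jordan's inequality has placed 4mε below π, so this sine is at most 0.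
  have hneg : Real.sin (4 * m * θ) = - Real.sin (4 * m * ε) := by
    rw [← Real.sin_neg, ← Real.sin_add_nat_mul_two_pi (-(4 * m * ε)) m]
    congr 1
    rw [hε]; ring
  have hpos : 0 ≤ Real.sin (4 * m * ε) :=
    Real.sin_nonneg_of_nonneg_of_le_pi (by have : 0 < ε := by linarith
                                           positivity) hlt.le
  rw [hneg]
  have : 0 ≤ (m : ℝ) * Real.sin (2 * θ) := by positivity
  linarith

/-! ## Good edges -/

namespace SpanningTree

open Finset

variable {n : ℕ}

/-- The number of components of the graph with edge set `A`. -/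
noncomputable def numComponents (A : Finset (Sym2 (Fin n))) : ℕ :=
  Fintype.card (graphOf A).ConnectedComponent

/-- The entry `i, j` of `M` is one and joins different components of `A`. -/
def IsGood (M : Matrix (Fin n) (Fin n) Bool) (A : Finset (Sym2 (Fin n))) (p : Fin n × Fin n) :
    Prop :=
  M p.1 p.2 = true ∧ ¬ (graphOf A).Reachable p.1 p.2

/-- The set of all good pairs. -/
noncomputable def goodPairs (M : Matrix (Fin n) (Fin n) Bool) (A : Finset (Sym2 (Fin n))) :
    Finset (Fin n × Fin n) :=
  univ.filter (IsGood M A)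

theorem graphOf_insert (A : Finset (Sym2 (Fin n))) (i j : Fin n) :
    graphOf (insert s(i, j) A) = graphOf A ⊔ SimpleGraph.edge i j := by
  rw [graphOf, coe_insert, Set.insert_eq, Set.union_comm, SimpleGraph.fromEdgeSet_union]
  rfl

theorem numComponents_insert_lt {A : Finset (Sym2 (Fin n))} {i j : Fin n}
    (h : ¬ (graphOf A).Reachable i j) :
    numComponents (insert s(i, j) A) < numComponents A := by
  have hle : graphOf A ≤ graphOf (insert s(i, j) A) := by
    rw [graphOf_insert]; exact le_sup_left
  let f : (graphOf A).ConnectedComponent → (graphOf (insert s(i, j) A)).ConnectedComponent :=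
    SimpleGraph.ConnectedComponent.map (SimpleGraph.Hom.ofLE hle)
  have hij : i ≠ j := fun e => h (e ▸ SimpleGraph.Reachable.refl _)
  refine Fintype.card_lt_of_surjective_not_injective f ?_ fun hinj => h ?_
  · intro c
    induction c using SimpleGraph.ConnectedComponent.ind with
    | h v => exact ⟨(graphOf A).connectedComponentMk v, rfl⟩
  · refine SimpleGraph.ConnectedComponent.exact (hinj ?_)
    refine SimpleGraph.ConnectedComponent.sound (SimpleGraph.Adj.reachable ?_)
    simp [hij]

theorem numComponents_le (A : Finset (Sym2 (Fin n))) : numComponents A ≤ n := by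
  have := Fintype.card_le_of_surjective (graphOf A).connectedComponentMk Quot.mk_surjective
  simpa [numComponents] using this

theorem one_lt_numComponents [NeZero n] {A : Finset (Sym2 (Fin n))}
    (h : ¬ (graphOf A).Connected) : 1 < numComponents A := by
  rw [numComponents, Fintype.one_lt_card_iff_nontrivial]
  by_contra hn
  rw [not_nontrivial_iff_subsingleton] at hn
  refine h ⟨fun u v => SimpleGraph.ConnectedComponent.exact (Subsingleton.elim _ _)⟩

/-- Each component is assigned a good pair that starts in it. Pairs of different components have
different first entries, so the assignment is injective. -/
theorem numComponents_le_card_goodPairs {G : SimpleGraph (Fin n)}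
    {M : Matrix (Fin n) (Fin n) Bool} (hM : ∀ i j, i ≠ j → (M i j = true ↔ G.Adj i j))
    (hG : G.Connected) {A : Finset (Sym2 (Fin n))} (h : ¬ (graphOf A).Connected) :
    numComponents A ≤ #(goodPairs M A) := by
  have key : ∀ c : (graphOf A).ConnectedComponent, ∃ p : Fin n × Fin n, IsGood M A p ∧
      (graphOf A).connectedComponentMk p.1 = c := by
    intro c
    obtain ⟨u, rfl⟩ := c.exists_rep
    obtain ⟨v, hv⟩ : ∃ v, (graphOf A).connectedComponentMk v ≠
        (graphOf A).connectedComponentMk u := by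
      by_contra! hall
      have := hG.nonempty
      exact h ⟨fun a b => SimpleGraph.ConnectedComponent.exact ((hall a).trans (hall b).symm)⟩
    obtain ⟨w⟩ := hG.preconnected u v
    -- A walk in G from the component of u to a vertex outside it must cross the boundary; the
    -- crossing edge is good.
    obtain ⟨d, -, hd1, hd2⟩ := w.exists_boundary_dart
      {x | (graphOf A).connectedComponentMk x = (graphOf A).connectedComponentMk u} rfl hv
    refine ⟨(d.fst, d.snd), ⟨(hM _ _ d.adj.ne).2 d.adj, fun hr => hd2 ?_⟩, hd1⟩
    exact (SimpleGraph.ConnectedComponent.sound hr.symm).trans hd1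
  choose f hf hf' using key
  rw [numComponents, ← card_univ]
  refine card_le_card_of_injOn f (fun c _ => by simp [goodPairs, hf]) ?_
  intro c _ d _ hcd
  rw [← hf' c, hcd, hf' d]

/-- A diagonal pair is never good. Strictness keeps the angle below π/2, so that dividing by its
cosine is legitimate. -/
theorem card_goodPairs_lt [NeZero n] (M : Matrix (Fin n) (Fin n) Bool)
    (A : Finset (Sym2 (Fin n))) : #(goodPairs M A) < n ^ 2 := by
  have h : goodPairs M A ⊂ univ := by
    rw [ssubset_univ_iff]
    intro he
    have := mem_univ ((0, 0) : Fin n × Fin n)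
    rw [← he] at this
    simp [goodPairs, IsGood] at this
  have := card_lt_card h
  simpa [sq] using this

end SpanningTree

/-! ## The state after a number of Grover iterations -/

namespace SpanningTree

open Finset

variable {n : ℕ}

/-- The superposition with amplitude `α` on the good pairs and `β` on the others, relative to
the uniform superposition. -/
noncomputable def groverVec (M : Matrix (Fin n) (Fin n) Bool) (A : Finset (Sym2 (Fin n)))
    (α β : ℝ) : QState n Unit :=
  WithLp.toLp 2 fun x =>
    ((if IsGood M A (x.1, x.2.1) then α else β : ℝ) : ℂ) * uniformVec n x

theorem maskUnitary_apply (A : Finset (Sym2 (Fin n))) (ψ : QState n Unit) (x : QBasis n Unit) :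
    maskUnitary A ψ x =
      if x.2.2.1 = true ∧ (graphOf A).Reachable x.1 x.2.1 then -ψ x else ψ x := by
  rw [maskUnitary, LinearIsometryEquiv.piLpCongrRight_apply]
  split_ifs with h <;> simp [h]

theorem oracle_apply (M : Matrix (Fin n) (Fin n) Bool) (ψ : QState n Unit) (x : QBasis n Unit) :
    oracle Unit M ψ x = ψ (x.1, x.2.1, xor x.2.2.1 (M x.1 x.2.1), x.2.2.2) := by
  rw [oracle, LinearIsometryEquiv.piLpCongrLeft_apply]
  rfl

/-- On a pair inside one component, the mask acts as Pauli Z on the answer bit. As Z X Z = -X,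
conjugation cancels the sign that the query's bit flip gives to (|0⟩ - |1⟩)/√2. Elsewhere the mask
is trivial and that sign remains. -/
theorem phaseFlip_groverVec (M : Matrix (Fin n) (Fin n) Bool) (A : Finset (Sym2 (Fin n)))
    (α β : ℝ) :
    maskUnitary A (oracle Unit M (maskUnitary A (groverVec M A α β))) =
      groverVec M A (-α) β := by
  ext ⟨i, j, b, w⟩
  simp only [maskUnitary_apply, oracle_apply]
  by_cases hr : (graphOf A).Reachable i j <;> cases hM : M i j <;> cases b <;>
    simp [groverVec, IsGood, uniformVec, hr, hM] <;> ring

theorem sum_pairs_ite (M : Matrix (Fin n) (Fin n) Bool) (A : Finset (Sym2 (Fin n)))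
    (a b : ℝ) :
    ∑ x : QBasis n Unit, (if IsGood M A (x.1, x.2.1) then a else b) =
      2 * (#(goodPairs M A) * a + ((n : ℝ) ^ 2 - #(goodPairs M A)) * b) := by
  have h1 : ∑ x : QBasis n Unit, (if IsGood M A (x.1, x.2.1) then a else b) =
      2 * ∑ p : Fin n × Fin n, (if IsGood M A p then a else b) := by
    simp only [Fintype.sum_prod_type, Fintype.sum_bool, univ_unique, sum_singleton, mul_sum]
    simp only [two_mul]
  rw [h1, sum_ite]
  have h2 : #(univ.filter fun p => ¬ IsGood M A p) = n ^ 2 - #(goodPairs M A) := by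
    rw [← compl_filter, card_compl]
    simp [goodPairs, sq]
  have h3 : #(goodPairs M A) ≤ n ^ 2 := by
    have := card_le_univ (goodPairs M A)
    simpa [sq] using this
  rw [sum_const, sum_const, h2, nsmul_eq_mul, nsmul_eq_mul, Nat.cast_sub h3, goodPairs]
  push_cast
  ring

theorem norm_uniformVec_apply_sq (x : QBasis n Unit) :
    ‖uniformVec n x‖ ^ 2 = 1 / (2 * (n : ℝ) ^ 2) := by
  have h1 : ‖(if x.2.2.1 then (-1 : ℂ) else 1)‖ = 1 := by split_ifs <;> simp
  simp only [uniformVec, norm_div, norm_mul, h1]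
  rw [div_pow, mul_pow]
  simp
  ring

theorem inner_uniformVec_groverVec [NeZero n] (M : Matrix (Fin n) (Fin n) Bool)
    (A : Finset (Sym2 (Fin n))) (α β : ℝ) :
    inner ℂ (uniformVec n) (groverVec M A α β) =
      (((#(goodPairs M A) * α + ((n : ℝ) ^ 2 - #(goodPairs M A)) * β) / (n : ℝ) ^ 2 : ℝ) : ℂ) := by
  have hn : (n : ℝ) ≠ 0 := Nat.cast_ne_zero.mpr (NeZero.ne n)
  have h : ∀ x : QBasis n Unit, inner ℂ (uniformVec n x) (groverVec M A α β x) =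
      (((if IsGood M A (x.1, x.2.1) then α else β) * (1 / (2 * (n : ℝ) ^ 2)) : ℝ) : ℂ) := by
    intro x
    rw [← norm_uniformVec_apply_sq x, groverVec, PiLp.toLp_apply, RCLike.inner_apply, mul_assoc,
      RCLike.mul_conj]
    push_cast
    rfl
  rw [PiLp.inner_apply, sum_congr rfl fun x _ => h x, ← Complex.ofReal_sum, ← sum_mul,
    sum_pairs_ite]
  congr 1
  field_simp

theorem diffusion_groverVec [NeZero n] (M : Matrix (Fin n) (Fin n) Bool)
    (A : Finset (Sym2 (Fin n))) (α β μ : ℝ)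
    (hμ : (#(goodPairs M A) * α + ((n : ℝ) ^ 2 - #(goodPairs M A)) * β) / (n : ℝ) ^ 2 = μ) :
    diffusion n (groverVec M A α β) = groverVec M A (2 * μ - α) (2 * μ - β) := by
  rw [diffusion, Submodule.reflection_singleton_apply, inner_uniformVec_groverVec, hμ,
    norm_uniformVec]
  ext x
  simp only [groverVec, PiLp.sub_apply, PiLp.smul_apply, PiLp.toLp_apply, nsmul_eq_mul,
    smul_eq_mul]
  split_ifs <;> push_cast <;> simp <;> ring

theorem uniformVec_eq_groverVec (M : Matrix (Fin n) (Fin n) Bool) (A : Finset (Sym2 (Fin n))) :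
    uniformVec n = groverVec M A 1 1 := by
  ext x
  simp [groverVec]

theorem run_append (M : Matrix (Fin n) (Fin n) Bool) (c d : List (Gate n Unit))
    (ψ : QState n Unit) : Gate.run M (c ++ d) ψ = Gate.run M d (Gate.run M c ψ) := by
  simp [Gate.run, List.foldl_append]

/-- The angle of the search: the square of its sine is the proportion of good pairs. -/
noncomputable def angle (M : Matrix (Fin n) (Fin n) Bool) (A : Finset (Sym2 (Fin n))) : ℝ :=
  Real.arcsin (Real.sqrt (#(goodPairs M A)) / n)

section Angle

variable [NeZero n] (M : Matrix (Fin n) (Fin n) Bool) (A : Finset (Sym2 (Fin n)))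

theorem sqrt_card_goodPairs_lt : Real.sqrt (#(goodPairs M A)) / n < 1 := by
  have hn : (0 : ℝ) < n := Nat.cast_pos.mpr (NeZero.pos n)
  rw [div_lt_one hn, Real.sqrt_lt' hn]
  exact_mod_cast card_goodPairs_lt M A

theorem sin_angle : Real.sin (angle M A) = Real.sqrt (#(goodPairs M A)) / n :=
  Real.sin_arcsin (by linarith [show 0 ≤ Real.sqrt (#(goodPairs M A)) / n by positivity])
    (sqrt_card_goodPairs_lt M A).le

theorem angle_lt : angle M A < Real.pi / 2 :=
  Real.arcsin_lt_pi_div_two.2 (sqrt_card_goodPairs_lt M A)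

variable {M A}

theorem angle_pos (h : 0 < #(goodPairs M A)) : 0 < angle M A := by
  have hn : (0 : ℝ) < n := Nat.cast_pos.mpr (NeZero.pos n)
  have h' : (0 : ℝ) < #(goodPairs M A) := Nat.cast_pos.mpr h
  exact Real.arcsin_pos.2 (by positivity)

theorem card_goodPairs_eq : (#(goodPairs M A) : ℝ) = Real.sin (angle M A) ^ 2 * (n : ℝ) ^ 2 := by
  have hn : (n : ℝ) ≠ 0 := Nat.cast_ne_zero.mpr (NeZero.ne n)
  rw [sin_angle, div_pow, Real.sq_sqrt (Nat.cast_nonneg _)]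
  field_simp

/-- Grover's rotation by 2θ. After the sign change the mean amplitude is cos(φ + θ), and inversion
about it gives the claim since sin(φ+2θ) - sin φ = 2 cos(φ+θ) sin θ, and similarly for the cosine.
-/
theorem run_groverIteration (h : 0 < #(goodPairs M A)) (φ : ℝ) :
    Gate.run M (groverIteration A) (groverVec M A (Real.sin φ / Real.sin (angle M A))
        (Real.cos φ / Real.cos (angle M A))) =
      groverVec M A (Real.sin (φ + 2 * angle M A) / Real.sin (angle M A))
        (Real.cos (φ + 2 * angle M A) / Real.cos (angle M A)) := by
  have hn : (n : ℝ) ≠ 0 := Nat.cast_ne_zero.mpr (NeZero.ne n)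
  have h0 := angle_pos h
  have h1 := angle_lt M A
  have hs : Real.sin (angle M A) ≠ 0 :=
    (Real.sin_pos_of_pos_of_lt_pi h0 (by linarith)).ne'
  have hc : Real.cos (angle M A) ≠ 0 :=
    (Real.cos_pos_of_mem_Ioo ⟨by linarith, by linarith⟩).ne'
  have e : Gate.run M (groverIteration A) (groverVec M A (Real.sin φ / Real.sin (angle M A))
        (Real.cos φ / Real.cos (angle M A))) =
      diffusion n (maskUnitary A (oracle Unit M (maskUnitary A
        (groverVec M A (Real.sin φ / Real.sin (angle M A))
        (Real.cos φ / Real.cos (angle M A)))))) := rfl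
  rw [e, phaseFlip_groverVec, diffusion_groverVec M A _ _ (Real.cos (φ + angle M A))]
  · have h2 : φ + 2 * angle M A = (φ + angle M A) + angle M A := by ring
    have h3 : Real.sin φ = Real.sin ((φ + angle M A) - angle M A) := by congr 1; ring
    have h4 : Real.cos φ = Real.cos ((φ + angle M A) - angle M A) := by congr 1; ring
    rw [h2, h3, h4, Real.sin_sub, Real.cos_sub, Real.sin_add (φ + angle M A),
      Real.cos_add (φ + angle M A)]
    congr 1 <;> field_simp <;> ring
  · rw [card_goodPairs_eq, Real.cos_add]
    have hcs : (n : ℝ) ^ 2 - Real.sin (angle M A) ^ 2 * (n : ℝ) ^ 2 =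
        Real.cos (angle M A) ^ 2 * (n : ℝ) ^ 2 := by
      rw [Real.cos_sq']; ring
    rw [hcs]
    field_simp
    ring

theorem run_groverIterations (h : 0 < #(goodPairs M A)) (l : ℕ) :
    Gate.run M (List.replicate l (groverIteration A)).flatten (uniformVec n) =
      groverVec M A (Real.sin ((2 * l + 1) * angle M A) / Real.sin (angle M A))
        (Real.cos ((2 * l + 1) * angle M A) / Real.cos (angle M A)) := by
  induction l with
  | zero =>
    have h0 := angle_pos h
    have h1 := angle_lt M A
    have hs : Real.sin (angle M A) ≠ 0 :=
      (Real.sin_pos_of_pos_of_lt_pi h0 (by linarith)).ne'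
    have hc : Real.cos (angle M A) ≠ 0 :=
      (Real.cos_pos_of_mem_Ioo ⟨by linarith, by linarith⟩).ne'
    simp [Gate.run, div_self hs, div_self hc, ← uniformVec_eq_groverVec]
  | succ l ih =>
    rw [List.replicate_succ', List.flatten_append, run_append, ih, List.flatten_singleton,
      run_groverIteration h]
    congr 3 <;> push_cast <;> ring_nf

theorem sum_normSq_not_good (h : 0 < #(goodPairs M A)) (l : ℕ) :
    ∑ x : QBasis n Unit, (if IsGood M A (x.1, x.2.1) then 0 else
        ‖Gate.run M (List.replicate l (groverIteration A)).flatten (uniformVec n) x‖ ^ 2) =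
      Real.cos ((2 * l + 1) * angle M A) ^ 2 := by
  have hn : (n : ℝ) ≠ 0 := Nat.cast_ne_zero.mpr (NeZero.ne n)
  have h0 := angle_pos h
  have h1 := angle_lt M A
  have hc : Real.cos (angle M A) ≠ 0 :=
    (Real.cos_pos_of_mem_Ioo ⟨by linarith, by linarith⟩).ne'
  rw [run_groverIterations h]
  set β := Real.cos ((2 * l + 1) * angle M A) / Real.cos (angle M A) with hβ
  have hx : ∀ x : QBasis n Unit, (if IsGood M A (x.1, x.2.1) then 0 else
        ‖groverVec M A (Real.sin ((2 * l + 1) * angle M A) / Real.sin (angle M A)) β x‖ ^ 2) =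
      if IsGood M A (x.1, x.2.1) then 0 else β ^ 2 * (1 / (2 * (n : ℝ) ^ 2)) := by
    intro x
    split_ifs with hg
    · rfl
    · rw [groverVec, PiLp.toLp_apply, if_neg hg, norm_mul, mul_pow, norm_uniformVec_apply_sq]
      simp
  rw [sum_congr rfl fun x _ => hx x, sum_pairs_ite, card_goodPairs_eq]
  have hcs : (n : ℝ) ^ 2 - Real.sin (angle M A) ^ 2 * (n : ℝ) ^ 2 =
      Real.cos (angle M A) ^ 2 * (n : ℝ) ^ 2 := by
    rw [Real.cos_sq']; ring
  rw [hcs, hβ]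
  field_simp
  ring

end Angle

theorem queries_groverIterations (A : Finset (Sym2 (Fin n))) (l : ℕ) :
    ((List.replicate l (groverIteration A)).flatten.map Gate.queries).sum = l := by
  induction l with
  | zero => rfl
  | succ l ih =>
    rw [List.replicate_succ, List.flatten_cons, List.map_append, List.sum_append, ih]
    simp [groverIteration, Gate.queries, add_comm]

end SpanningTree

/-! ## The steps of the greedy algorithm -/

namespace SpanningTree

open Finset

variable {n : ℕ} [NeZero n]

/-- The distribution of the configuration after one step of the greedy algorithm. -/
noncomputable def greedyStep (M : Matrix (Fin n) (Fin n) Bool) :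
    Memory n × ℕ → PMF (Memory n × ℕ) :=
  (greedy n).step M

theorem greedyStep_start_of_connected (M : Matrix (Fin n) (Fin n) Bool)
    {A : Finset (Sym2 (Fin n))} (hA : (graphOf A).Connected) (r q : ℕ) :
    greedyStep M (.start A r, q) = PMF.pure (.start A r, q) := by
  have h : (greedy n).action (Memory.start A r) = .halt A := if_pos hA
  simp only [greedyStep, QueryAlgorithm.step]
  rw [h]
  rfl

theorem greedyStep_start (M : Matrix (Fin n) (Fin n) Bool)
    {A : Finset (Sym2 (Fin n))} (hA : ¬ (graphOf A).Connected) (r q : ℕ) :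
    greedyStep M (.start A r, q) =
      (PMF.uniformOfFinset (range (roundBound n r))
        (nonempty_range_iff.mpr (roundBound_pos n r).ne')).map
          fun l => (Memory.grover A r l, q) := by
  have h : (greedy n).action (Memory.start A r) = _ := if_neg hA
  simp only [greedyStep, QueryAlgorithm.step]
  rw [h]
  exact PMF.map_comp _ _ _

theorem greedyStep_grover (M : Matrix (Fin n) (Fin n) Bool) (A : Finset (Sym2 (Fin n)))
    (r l q : ℕ) :
    greedyStep M (.grover A r l, q) =
      (measurePMF (Gate.run M (List.replicate l (groverIteration A)).flatten (uniformVec n))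
        (by rw [Gate.norm_run, norm_uniformVec])).map
          fun x => (Memory.check A r x.1 x.2.1, q + l) := by
  have h : greedyStep M (.grover A r l, q) =
      (measurePMF (Gate.run M (List.replicate l (groverIteration A)).flatten (uniformVec n))
        (by rw [Gate.norm_run, norm_uniformVec])).map
          fun x => (Memory.check A r x.1 x.2.1,
            q + ((List.replicate l (groverIteration A)).flatten.map Gate.queries).sum) := rfl
  rw [h, queries_groverIterations]

omit [NeZero n] in
theorem measurePMF_eq_pure (ψ : QState n Unit) (h : ‖ψ‖ = 1) (x : QBasis n Unit)
    (hx : ψ = EuclideanSpace.single x 1) : measurePMF ψ h = PMF.pure x := by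
  subst hx
  ext y
  change ENNReal.ofReal _ = _
  by_cases hy : y = x <;> simp [hy, PMF.pure_apply]

theorem greedyStep_check (M : Matrix (Fin n) (Fin n) Bool) (A : Finset (Sym2 (Fin n)))
    (r : ℕ) (i j : Fin n) (q : ℕ) :
    greedyStep M (.check A r i j, q) =
      PMF.pure (if IsGood M A (i, j) then Memory.start (insert s(i, j) A) 0
        else Memory.start A (r + 1), q + 1) := by
  have h : Gate.run M [Gate.query] (entryState i j).1 =
      EuclideanSpace.single (i, j, M i j, ()) 1 := by
    have e : Gate.run M [Gate.query] (entryState i j).1 =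
      oracle Unit M (EuclideanSpace.single (i, j, false, ()) 1) := rfl
    rw [e]
    ext ⟨i', j', b, w⟩
    rw [oracle_apply, PiLp.single_apply, PiLp.single_apply]
    congr 1
    simp only [Prod.mk.injEq, eq_iff_iff, and_true]
    constructor
    · rintro ⟨rfl, rfl, h⟩
      cases b <;> simp_all
    · rintro ⟨rfl, rfl, rfl⟩
      simp
  have e : greedyStep M (.check A r i j, q) =
      (measurePMF (Gate.run M [Gate.query] (entryState i j).1)
        (by rw [Gate.norm_run]; exact mem_sphere_zero_iff_norm.mp (entryState i j).2)).map
      fun x => (if x.2.2.1 = true ∧ ¬ (graphOf A).Reachable i j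
          then Memory.start (insert s(i, j) A) 0 else Memory.start A (r + 1), q + 1) := rfl
  rw [e, measurePMF_eq_pure _ _ _ h, PMF.pure_map]
  congr

/-! ## The potential function -/

/-- An upper bound for the expected number of queries of a search from round `r` on, when there
are `c` components. -/
noncomputable def searchCost (n c r : ℕ) : ℝ :=
  if (6 / 5 : ℝ) ^ r < n / Real.sqrt c then 36 * (n / Real.sqrt c) - 10 * (6 / 5) ^ r
  else 20 * (6 / 5) ^ r

/-- An upper bound for the expected number of queries of the searches that start with fewer than
`c` components. -/
noncomputable def laterCost (n c : ℕ) : ℝ := ∑ k ∈ range c, 36 * (n / Real.sqrt k)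

/-- An upper bound for the expected number of further queries. -/
noncomputable def potential (M : Matrix (Fin n) (Fin n) Bool) : Memory n → ℝ≥0∞
  | .start A r => if (graphOf A).Connected then 0 else
      ENNReal.ofReal (laterCost n (numComponents A) + searchCost n (numComponents A) r)
  | .grover A r l => ENNReal.ofReal (l + 1 + laterCost n (numComponents A) +
      Real.cos ((2 * l + 1) * angle M A) ^ 2 * searchCost n (numComponents A) (r + 1))
  | .check A r i j => ENNReal.ofReal (1 + laterCost n (numComponents A) +
      if IsGood M A (i, j) then 0 else searchCost n (numComponents A) (r + 1))

omit [NeZero n] in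
theorem searchCost_nonneg (n c r : ℕ) : 0 ≤ searchCost n c r := by
  have : (0 : ℝ) < (6 / 5) ^ r := by positivity
  rw [searchCost]
  split_ifs <;> linarith

theorem laterCost_nonneg (n c : ℕ) : 0 ≤ laterCost n c :=
  sum_nonneg fun _ _ => by positivity

theorem laterCost_mono (n : ℕ) : Monotone (laterCost n) := fun _ _ h =>
  sum_le_sum_of_subset_of_nonneg (range_mono h) fun _ _ _ => by positivity

/-- The cost of a fresh search is at most 36 n/√c, the next summand. In the second branch of
`searchCost` the value is 20, which is enough because n/√c ≥ 1. -/
theorem laterCost_add_searchCost_le {c : ℕ} (h0 : 0 < c) (hc : c ≤ n) :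
    laterCost n c + searchCost n c 0 ≤ laterCost n (c + 1) := by
  have h0' : (0 : ℝ) < c := Nat.cast_pos.2 h0
  have h1 : 1 ≤ (n : ℝ) / Real.sqrt c := by
    rw [le_div_iff₀ (Real.sqrt_pos.2 h0'), one_mul, Real.sqrt_le_left (Nat.cast_nonneg n)]
    have : (1 : ℝ) ≤ n := Nat.one_le_cast.2 (NeZero.pos n)
    have : (c : ℝ) ≤ n := Nat.cast_le.2 hc
    nlinarith
  rw [laterCost, laterCost, sum_range_succ, searchCost]
  split_ifs <;> simp only [pow_zero] <;> linarith

theorem laterCost_succ_le (n c : ℕ) : laterCost n (c + 1) ≤ 72 * (n * Real.sqrt c) := by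
  have h : ∑ k ∈ range (c + 1), 1 / Real.sqrt k ≤ 2 * Real.sqrt c := by
    induction c with
    -- The only term is `1 / √0`, which is 0 by convention.
    | zero => simp
    | succ c ih =>
      rw [sum_range_succ]
      have h1 : (0 : ℝ) < Real.sqrt ((c + 1 : ℕ) : ℝ) := Real.sqrt_pos.2 (by positivity)
      have h2 := Real.sq_sqrt (Nat.cast_nonneg (α := ℝ) (c + 1))
      have h3 := Real.sq_sqrt (Nat.cast_nonneg (α := ℝ) c)
      have h4 : 1 / Real.sqrt ((c + 1 : ℕ) : ℝ) ≤
          2 * Real.sqrt ((c + 1 : ℕ) : ℝ) - 2 * Real.sqrt c := by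
        rw [div_le_iff₀ h1]
        push_cast at *
        nlinarith [sq_nonneg (Real.sqrt (c + 1) - Real.sqrt c)]
      linarith
  have e : laterCost n (c + 1) = 36 * n * ∑ k ∈ range (c + 1), 1 / Real.sqrt k := by
    rw [laterCost, mul_sum]
    exact sum_congr rfl fun k _ => by ring
  rw [e]
  have := mul_le_mul_of_nonneg_left h (show (0 : ℝ) ≤ 36 * n by positivity)
  linarith

theorem roundBound_le (n r : ℕ) : (roundBound n r : ℝ) ≤ 2 * (6 / 5) ^ r := by
  have h1 : (1 : ℝ) ≤ (6 / 5) ^ r := one_le_pow₀ (by norm_num)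
  have h2 : (roundBound n r : ℝ) < min ((6 / 5 : ℝ) ^ r) n + 1 := Nat.ceil_lt_add_one (by positivity)
  have := min_le_left ((6 / 5 : ℝ) ^ r) n
  linarith

/-- One round, multiplied by the number m of choices of l. The constants of `searchCost` make it
balance. Put x = (6/5)^r and X = n/√c; a round costs at most m ≤ 2x queries on average. Below the
threshold, 36X - 12x + 2x = 36X - 10x. When crossing it, 24x + 2x ≤ 36X - 10x because x < X. Above
it, 3/4 · 24x + 2x = 20x. -/
theorem sum_round_le (M : Matrix (Fin n) (Fin n) Bool) {A : Finset (Sym2 (Fin n))}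
    (h0 : 0 < numComponents A) (h : numComponents A ≤ #(goodPairs M A)) (r : ℕ) :
    ∑ l ∈ range (roundBound n r), (l + 1 + laterCost n (numComponents A) +
      Real.cos ((2 * l + 1) * angle M A) ^ 2 * searchCost n (numComponents A) (r + 1)) ≤
    roundBound n r * (laterCost n (numComponents A) + searchCost n (numComponents A) r) := by
  set c := numComponents A with hcdef
  set m := roundBound n r with hm
  have hn : (0 : ℝ) < n := Nat.cast_pos.mpr (NeZero.pos n)
  have hsc : 0 < Real.sqrt c := Real.sqrt_pos.2 (Nat.cast_pos.2 h0)
  have hsc1 : 1 ≤ Real.sqrt c := Real.one_le_sqrt.2 (Nat.one_le_cast.2 h0)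
  have hx : (0 : ℝ) < (6 / 5) ^ r := by positivity
  have hm2 : (m : ℝ) ≤ 2 * (6 / 5) ^ r := roundBound_le n r
  have hnn := searchCost_nonneg n c (r + 1)
  have hlin : ∑ l ∈ range m, ((l : ℝ) + 1) ≤ m * m := by
    have : ∑ l ∈ range m, ((l : ℝ) + 1) ≤ ∑ l ∈ range m, (m : ℝ) :=
      sum_le_sum fun l hl => by exact_mod_cast mem_range.1 hl
    simpa using this
  simp only [sum_add_distrib, ← sum_mul] at hlin ⊢
  set K := ∑ l ∈ range m, Real.cos ((2 * l + 1) * angle M A) ^ 2 with hK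
  suffices hs : K * searchCost n c (r + 1) + m * m ≤ m * searchCost n c r by
    simp only [sum_const, card_range, nsmul_eq_mul] at hlin ⊢
    linarith
  have hmn : (0 : ℝ) ≤ m := Nat.cast_nonneg m
  by_cases hlt : (6 / 5 : ℝ) ^ r < n / Real.sqrt c
  · have hK1 : K ≤ m := by
      have : K ≤ ∑ l ∈ range m, (1 : ℝ) := sum_le_sum fun l _ => Real.cos_sq_le_one _
      simpa using this
    have h1 : searchCost n c (r + 1) + m ≤ searchCost n c r := by
      simp only [searchCost, if_pos hlt, pow_succ]
      split_ifs <;> linarith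
    have := mul_le_mul_of_nonneg_right hK1 hnn
    have := mul_le_mul_of_nonneg_left h1 hmn
    linarith
  · push Not at hlt
    have hK1 : K ≤ 3 / 4 * m := by
      refine sum_cos_sq_le (angle_pos (h0.trans_le h)) (angle_lt M A) ?_
      have h1 : n / Real.sqrt c ≤ m := by
        -- The cap n on the round length does no harm, since n/√c ≤ n.
        refine le_trans (le_min hlt ?_) (Nat.le_ceil _)
        exact div_le_self hn.le hsc1
      have h2 : Real.sqrt c ≤ Real.sqrt (#(goodPairs M A)) :=
        Real.sqrt_le_sqrt (Nat.cast_le.2 h)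
      rw [div_le_iff₀ hsc] at h1
      rw [sin_angle, ← mul_div_assoc, le_div_iff₀ hn, one_mul]
      exact h1.trans (mul_le_mul_of_nonneg_left h2 hmn)
    have h1 : 3 / 4 * searchCost n c (r + 1) + m ≤ searchCost n c r := by
      have h2 : ¬ (6 / 5 : ℝ) ^ (r + 1) < n / Real.sqrt c := by
        rw [pow_succ]; linarith
      rw [searchCost, searchCost, if_neg hlt.not_gt, if_neg h2, pow_succ]
      linarith
    have := mul_le_mul_of_nonneg_right hK1 hnn
    have := mul_le_mul_of_nonneg_left h1 hmn
    linarith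

/-- The number of queries made, plus the potential. -/
noncomputable def totalCost (M : Matrix (Fin n) (Fin n) Bool) (x : Memory n × ℕ) : ℝ≥0∞ :=
  x.2 + potential M x.1

theorem expect_totalCost_start_le (M : Matrix (Fin n) (Fin n) Bool) {A : Finset (Sym2 (Fin n))}
    (hA : ¬ (graphOf A).Connected) (h : numComponents A ≤ #(goodPairs M A)) (r q : ℕ) :
    (greedyStep M (.start A r, q)).expect (totalCost M) ≤ totalCost M (.start A r, q) := by
  have hm := roundBound_pos n r
  rw [greedyStep_start M hA, PMF.expect_map]
  simp only [totalCost]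
  rw [PMF.expect_const_add, PMF.expect_uniformOfFinset, card_range]
  refine add_le_add_right ?_ _
  have hm0 : (roundBound n r : ℝ≥0∞) ≠ 0 := Nat.cast_ne_zero.2 hm.ne'
  rw [ENNReal.inv_mul_le_iff hm0 (ENNReal.natCast_ne_top _)]
  simp only [potential, if_neg hA]
  rw [← ENNReal.ofReal_sum_of_nonneg, ← ENNReal.ofReal_natCast (roundBound n r),
    ← ENNReal.ofReal_mul (Nat.cast_nonneg _)]
  · exact ENNReal.ofReal_le_ofReal
      (sum_round_le M ((one_lt_numComponents hA).trans' one_pos) h r)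
  · intro l _
    have := laterCost_nonneg n (numComponents A)
    have := searchCost_nonneg n (numComponents A) (r + 1)
    positivity

theorem expect_totalCost_grover_le (M : Matrix (Fin n) (Fin n) Bool) {A : Finset (Sym2 (Fin n))}
    (h : 0 < #(goodPairs M A)) (r l q : ℕ) :
    (greedyStep M (.grover A r l, q)).expect (totalCost M) ≤ totalCost M (.grover A r l, q) := by
  have hL := laterCost_nonneg n (numComponents A)
  have hS := searchCost_nonneg n (numComponents A) (r + 1)
  have e : ∀ x : QBasis n Unit, totalCost M (.check A r x.1 x.2.1, q + l) =
      (q + ENNReal.ofReal (l + 1 + laterCost n (numComponents A))) +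
        ENNReal.ofReal (if IsGood M A (x.1, x.2.1) then 0
          else searchCost n (numComponents A) (r + 1)) := by
    intro x
    have h1 : 0 ≤ if IsGood M A (x.1, x.2.1) then 0
        else searchCost n (numComponents A) (r + 1) := by split_ifs <;> simp [hS]
    simp only [totalCost, potential]
    rw [ENNReal.ofReal_add (by positivity) h1, add_assoc (l : ℝ),
      ENNReal.ofReal_add (p := l) (by positivity) (by positivity), ENNReal.ofReal_natCast]
    push_cast
    ring
  rw [greedyStep_grover, PMF.expect_map]
  simp only [e]
  rw [PMF.expect_const_add, expect_measurePMF, add_assoc]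
  simp only [totalCost, potential]
  refine add_le_add_right ?_ _
  rw [ENNReal.ofReal_add (p := l + 1 + laterCost n (numComponents A)) (by positivity)
    (by positivity), ← sum_normSq_not_good h l, sum_mul,
    ENNReal.ofReal_sum_of_nonneg]
  · refine add_le_add_right (sum_le_sum fun x _ => ?_) _
    rw [← ENNReal.ofReal_mul (by positivity)]
    split_ifs <;> simp
  · intro x _
    split_ifs <;> positivity

theorem expect_totalCost_check_le (M : Matrix (Fin n) (Fin n) Bool) {A : Finset (Sym2 (Fin n))}
    (hA : ¬ (graphOf A).Connected) (r : ℕ) (i j : Fin n) (q : ℕ) :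
    (greedyStep M (.check A r i j, q)).expect (totalCost M) ≤
      totalCost M (.check A r i j, q) := by
  have hL := laterCost_nonneg n (numComponents A)
  have hS := searchCost_nonneg n (numComponents A) (r + 1)
  rw [greedyStep_check, PMF.expect_pure]
  simp only [totalCost]
  rw [Nat.cast_add, add_assoc]
  refine add_le_add_right ?_ _
  by_cases hg : IsGood M A (i, j)
  · simp only [potential, if_pos hg]
    rw [add_zero, ENNReal.ofReal_add zero_le_one hL, ENNReal.ofReal_one, Nat.cast_one]
    refine add_le_add_right ?_ _
    split_ifs with hc
    · exact zero_le
    · refine ENNReal.ofReal_le_ofReal (le_trans (laterCost_add_searchCost_le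
        ((one_lt_numComponents hc).trans' one_pos) (numComponents_le _)) ?_)
      -- The new number c' of components satisfies c' + 1 ≤ c; the insertion need not be shown to
      -- lower c by exactly one.
      exact laterCost_mono n (numComponents_insert_lt hg.2)
  · simp only [potential, if_neg hg, if_neg hA]
    rw [add_assoc, ENNReal.ofReal_add zero_le_one (by positivity), ENNReal.ofReal_one,
      Nat.cast_one]

theorem potential_init_le (M : Matrix (Fin n) (Fin n) Bool) :
    potential M (.start ∅ 0) ≤ ENNReal.ofReal (72 * (n : ℝ) ^ (3 / 2 : ℝ)) := by
  have hn : (0 : ℝ) < n := Nat.cast_pos.mpr (NeZero.pos n)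
  rw [potential]
  split_ifs with hA
  · exact zero_le
  refine ENNReal.ofReal_le_ofReal ?_
  have hc := numComponents_le (∅ : Finset (Sym2 (Fin n)))
  refine (laterCost_add_searchCost_le ((one_lt_numComponents hA).trans' one_pos) hc).trans ?_
  refine (laterCost_mono n (Nat.succ_le_succ hc)).trans ((laterCost_succ_le n n).trans_eq ?_)
  rw [Real.sqrt_eq_rpow, show (3 / 2 : ℝ) = 1 + 1 / 2 by norm_num, Real.rpow_add hn, Real.rpow_one]

/-! ## Reachable configurations -/

/-- The edge set `A` is a forest in `G`. -/
def IsForestIn (G : SimpleGraph (Fin n)) (A : Finset (Sym2 (Fin n))) : Prop :=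
  (A : Set (Sym2 (Fin n))) ⊆ G.edgeSet ∧ (graphOf A).IsAcyclic

/-- A property of the configurations that are reached after `k` steps: the edges found form a
forest in `G`, and every third step before halting makes a query. -/
def ReachableConfig (G : SimpleGraph (Fin n)) (k : ℕ) : Memory n × ℕ → Prop
  | (.start A _, q) => IsForestIn G A ∧ ((graphOf A).Connected ∨ k ≤ 3 * q)
  | (.grover A _ _, q) => IsForestIn G A ∧ ¬ (graphOf A).Connected ∧ k ≤ 3 * q + 1
  | (.check A _ _ _, q) => IsForestIn G A ∧ ¬ (graphOf A).Connected ∧ k ≤ 3 * q + 2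

omit [NeZero n] in
theorem IsForestIn.insert {G : SimpleGraph (Fin n)} {M : Matrix (Fin n) (Fin n) Bool}
    (hM : ∀ i j, i ≠ j → (M i j = true ↔ G.Adj i j)) {A : Finset (Sym2 (Fin n))}
    (hA : IsForestIn G A) {i j : Fin n} (hg : IsGood M A (i, j)) :
    IsForestIn G (insert s(i, j) A) := by
  have hij : i ≠ j := fun e => hg.2 (e ▸ SimpleGraph.Reachable.refl _)
  constructor
  · rw [coe_insert, Set.insert_subset_iff]
    exact ⟨(hM i j hij).1 hg.1, hA.1⟩
  · rw [graphOf_insert]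
    exact hA.2.sup_edge_of_not_reachable hg.2

/-- Only the query of the check phase is counted on to pay for the three steps of a round, since l
may be 0. -/
theorem reachableConfig_step {G : SimpleGraph (Fin n)} {M : Matrix (Fin n) (Fin n) Bool}
    (hM : ∀ i j, i ≠ j → (M i j = true ↔ G.Adj i j)) (k : ℕ) (x : Memory n × ℕ)
    (hx : ReachableConfig G k x) (y : Memory n × ℕ) (hy : y ∈ (greedyStep M x).support) :
    ReachableConfig G (k + 1) y := by
  obtain ⟨s, q⟩ := x
  cases s with
  | start A r =>
    by_cases hA : (graphOf A).Connected
    · rw [greedyStep_start_of_connected M hA, PMF.mem_support_pure_iff] at hy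
      subst hy
      exact ⟨hx.1, Or.inl hA⟩
    · rw [greedyStep_start M hA, PMF.mem_support_map_iff] at hy
      obtain ⟨l, -, rfl⟩ := hy
      exact ⟨hx.1, hA, Nat.succ_le_succ (hx.2.resolve_left hA)⟩
  | grover A r l =>
    rw [greedyStep_grover, PMF.mem_support_map_iff] at hy
    obtain ⟨z, -, rfl⟩ := hy
    exact ⟨hx.1, hx.2.1, by have := hx.2.2; omega⟩
  | check A r i j =>
    rw [greedyStep_check, PMF.mem_support_pure_iff] at hy
    subst hy
    have hk : k + 1 ≤ 3 * (q + 1) := by have := hx.2.2; omega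
    split_ifs with hg
    · exact ⟨hx.1.insert hM hg, Or.inr hk⟩
    · exact ⟨hx.1, Or.inr hk⟩

theorem reachableConfig_of_mem_support {G : SimpleGraph (Fin n)}
    {M : Matrix (Fin n) (Fin n) Bool} (hM : ∀ i j, i ≠ j → (M i j = true ↔ G.Adj i j)) (k : ℕ)
    (x : Memory n × ℕ) (hx : x ∈ ((greedy n).runFor M k).support) : ReachableConfig G k x := by
  refine (greedy n).support_runFor_of_step M (ReachableConfig G) ?_ (reachableConfig_step hM) k x hx
  refine ⟨⟨by simp, ?_⟩, Or.inr (Nat.zero_le _)⟩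
  rw [graphOf, coe_empty, SimpleGraph.fromEdgeSet_empty]
  exact SimpleGraph.isAcyclic_bot

theorem expect_totalCost_le {G : SimpleGraph (Fin n)} {M : Matrix (Fin n) (Fin n) Bool}
    (hM : ∀ i j, i ≠ j → (M i j = true ↔ G.Adj i j)) (hG : G.Connected) (k : ℕ) :
    ((greedy n).runFor M k).expect (totalCost M) ≤
      ENNReal.ofReal (72 * (n : ℝ) ^ (3 / 2 : ℝ)) := by
  refine ((greedy n).expect_runFor_le M (totalCost M) ?_ k).trans ?_
  · intro k x hx
    have hx := reachableConfig_of_mem_support hM k x hx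
    change (greedyStep M x).expect (totalCost M) ≤ _
    obtain ⟨s, q⟩ := x
    cases s with
    | start A r =>
      by_cases hA : (graphOf A).Connected
      · exact (congrArg (fun p => PMF.expect p (totalCost M))
          (greedyStep_start_of_connected M hA r q)).trans (PMF.expect_pure _ _) |>.le
      · exact expect_totalCost_start_le M hA (numComponents_le_card_goodPairs hM hG hA) r q
    | grover A r l =>
      have hA := hx.2.1
      exact expect_totalCost_grover_le M (((one_lt_numComponents hA).trans' one_pos).trans_le
        (numComponents_le_card_goodPairs hM hG hA)) r l q
    | check A r i j => exact expect_totalCost_check_le M hx.2.1 r i j q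
  · refine le_trans (le_of_eq ?_) (potential_init_le M)
    change ((0 : ℕ) : ℝ≥0∞) + _ = _
    rw [Nat.cast_zero, zero_add]
    rfl

/-! ### Halting and correctness of the output -/

theorem greedy_action_eq_halt {s : Memory n} {A : Finset (Sym2 (Fin n))}
    (h : greedyControl n s = .halt A) : (∃ r, s = .start A r) ∧ (graphOf A).Connected := by
  cases s with
  | start B r =>
    rw [greedyControl] at h
    split_ifs at h with hB
    cases h
    exact ⟨⟨r, rfl⟩, hB⟩
  | grover B r l => cases h
  | check B r i j => cases h

omit [NeZero n] in
theorem connected_of_isForestIn {G : SimpleGraph (Fin n)} {A : Finset (Sym2 (Fin n))}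
    (hA : IsForestIn G A) (h : (graphOf A).Connected) : G.Connected := by
  refine h.mono fun u v huv => ?_
  rw [SimpleGraph.fromEdgeSet_adj] at huv
  exact hA.1 huv.1

theorem probOutput_eq_one {G : SimpleGraph (Fin n)} {M : Matrix (Fin n) (Fin n) Bool}
    (hM : ∀ i j, i ≠ j → (M i j = true ↔ G.Adj i j)) (hG : G.Connected) :
    (greedy n).probOutput M (IsSpanningTree G) = 1 := by
  set B := ENNReal.ofReal (72 * (n : ℝ) ^ (3 / 2 : ℝ)) with hB
  let S : Set ((greedy n).State × ℕ) :=
    {x | ∃ a, (greedy n).action x.1 = .halt a ∧ IsSpanningTree G a}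
  have hle : (greedy n).probOutput M (IsSpanningTree G) ≤ 1 :=
    iSup_le fun k => PMF.toOuterMeasure_le_one _ _
  -- Every configuration outside `S` at time k has k ≤ 3q + 2, and the expectation of q is at most
  -- `B`. So k times the probability of not having halted correctly stays bounded.
  have hk : ∀ k : ℕ, (k : ℝ≥0∞) ≤ k * (greedy n).probOutput M (IsSpanningTree G) +
      (2 + 3 * B) := by
    intro k
    have h1 : (k : ℝ≥0∞) ≤ k * ((greedy n).runFor M k).toOuterMeasure S +
        ((greedy n).runFor M k).expect fun x => 2 + 3 * totalCost M x := by
      refine PMF.le_mul_toOuterMeasure_add_expect _ fun x hx hS => ?_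
      have hx := reachableConfig_of_mem_support hM k x hx
      obtain ⟨s, q⟩ := x
      have hq : k ≤ 3 * q + 2 → (k : ℝ≥0∞) ≤ 2 + 3 * totalCost M (s, q) := by
        intro h
        have h3 : (k : ℝ≥0∞) ≤ 2 + 3 * q := by
          rw [add_comm]; exact_mod_cast h
        exact h3.trans (add_le_add_right (mul_le_mul_right le_self_add _) _)
      cases s with
      | start A r =>
        refine hq ((hx.2.resolve_left fun hA => hS ?_).trans (Nat.le_add_right _ _))
        exact ⟨A, if_pos hA, hx.1.1, hA, hx.1.2⟩
      | grover A r l => exact hq (hx.2.2.trans (Nat.le_succ _))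
      | check A r i j => exact hq hx.2.2
    refine h1.trans (add_le_add (mul_le_mul_right
      (le_iSup (fun k => ((greedy n).runFor M k).toOuterMeasure S) k) _) ?_)
    exact (PMF.expect_const_add _ _ _).trans_le (add_le_add_right
      ((PMF.expect_const_mul _ _ _).trans_le (mul_le_mul_right (expect_totalCost_le hM hG k) _)) _)
  refine le_antisymm hle ?_
  set p := (greedy n).probOutput M (IsSpanningTree G)
  have hp : p ≠ ⊤ := ne_top_of_le_ne_top ENNReal.one_ne_top hle
  have hD : 2 + 3 * B ≠ ⊤ := by simp [hB, ENNReal.mul_eq_top]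
  by_contra! hlt
  have hlt' : p.toReal < 1 := by
    simpa using (ENNReal.toReal_lt_toReal hp ENNReal.one_ne_top).2 hlt
  -- If p < 1, then k(1 - p) ≤ 2 + 3B would fail for large k.
  obtain ⟨k, hk'⟩ := exists_nat_gt ((2 + 3 * B).toReal / (1 - p.toReal))
  rw [div_lt_iff₀ (by linarith)] at hk'
  have h4 := ENNReal.toReal_mono (by finiteness) (hk k)
  rw [ENNReal.toReal_add (by finiteness) hD, ENNReal.toReal_mul, ENNReal.toReal_natCast] at h4
  linarith

end SpanningTree

theorem mainTheorem6 :
    ∃ C : ℝ, 0 < C ∧ ∀ (n : ℕ) [NeZero n] (G : SimpleGraph (Fin n))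
      (M : Matrix (Fin n) (Fin n) Bool),
      (∀ i j, i ≠ j → (M i j = true ↔ G.Adj i j)) →
        (G.Connected →
          (SpanningTree.greedy n).probOutput M (SpanningTree.IsSpanningTree G) = 1 ∧
          (SpanningTree.greedy n).expectedQueries M ≤
            ENNReal.ofReal (C * (n : ℝ) ^ (3 / 2 : ℝ))) ∧
        (¬ G.Connected → (SpanningTree.greedy n).RunsForever M) := by
  refine ⟨72, by norm_num, fun n _ G M hM => ⟨fun hG => ?_, fun hG => ?_⟩⟩
  · refine ⟨SpanningTree.probOutput_eq_one hM hG, iSup_le fun k => ?_⟩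
    refine le_trans (PMF.expect_mono fun x _ => ?_) (SpanningTree.expect_totalCost_le hM hG k)
    exact le_self_add
  · rintro k ⟨s, q⟩ hx A hs
    have hx := SpanningTree.reachableConfig_of_mem_support hM k _ hx
    obtain ⟨⟨r, rfl⟩, hA⟩ := SpanningTree.greedy_action_eq_halt hs
    exact hG (SpanningTree.connected_of_isForestIn hx.1 hA)
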